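/- All rings are associative with identity $1\neq 0$, not necessarily commutative. Write $U(R)$ for the group of units of a ring $R$ and $\mathrm{Id}(R)$ for its set of idempotents. A ring $R$ is called clean if every $a\in R$ can be written as $a=e+u$ with $e\in \mathrm{Id}(R)$ and $u\in U(R)$. It is called unit uniquely clean (UnitUC) if it is clean and, whenever $e+u=f+v$ with $e,f\in \mathrm{Id}(R)$ and $u,v\in U(R)$, there is $w\in U(R)$ with $e=w^{-1}fw$. A group is called a $2$-group if the order of each of its elements is a (finite) power of $2$, and locally finite if each of its finitely generated subgroups is finite. Theorem. Let $R$ be a ring and let $G$ be a group, and let $RG$ denote the group ring of $G$ over $R$. (1) If $RG$ is UnitUC, then $R$ is UnitUC and $G$ is a $2$-group. (2) If $R$ is UnitUC and $G$ is a locally finite $2$-group, then $RG$ is UnitUC. -/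

import Mathlib

/-- A ring is clean if each of its elements is the sum of an idempotent and a unit. -/
def CleanRing (R : Type*) [Ring R] : Prop :=
  ∀ a : R, ∃ (e : R) (u : Rˣ), IsIdempotentElem e ∧ a = e + u

/-- Equivalence `e ∼ f`: there is a unit `u` with `e = u⁻¹ f u`. -/
def UnitEquivalent {R : Type*} [Ring R] (e f : R) : Prop :=
  ∃ u : Rˣ, e = (↑u⁻¹ : R) * f * (u : R)

/-- A ring is unit uniquely clean if it is clean and the idempotents in any two clean
representations of the same element are equivalent. -/
def UnitUC (R : Type*) [Ring R] : Prop :=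
  CleanRing R ∧
    ∀ (e f : R) (u v : Rˣ), IsIdempotentElem e → IsIdempotentElem f →
      e + (u : R) = f + (v : R) → UnitEquivalent e f

/-- A group is locally finite if each of its finitely generated subgroups is finite. -/
def LocallyFiniteGroup (G : Type*) [Group G] : Prop :=
  ∀ H : Subgroup G, H.FG → Finite H

/-!
Write `J` for the Jacobson radical. The proof rests on a description of the UnitUC rings
(`UnitUC.iff_clean_and_one_sub_mem_jacobson`): they are the clean rings in which every unit is
congruent to `1` modulo `J`.

That units of a UnitUC ring lie in `1 + J` is shown as follows. Comparing `v⁻¹ = 0 + v⁻¹` with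
`v⁻¹ = e + (v⁻¹ - e)`, one sees that `1 - v` cannot have an invertible corner at a nonzero
idempotent `e`. A `2 × 2` matrix ring contains a unit `v` with `1 - v` a unit, so there are no
`2 × 2` matrix corners. By the exchange property of clean rings this forces
`e * R * (1 - e) ⊆ J` for every idempotent `e`, so idempotents are central modulo `J`. If now
`1 - v ∉ J`, the exchange property yields a nonzero idempotent multiple of `1 - v`, and its centrality
modulo `J` makes it the site of a forbidden invertible corner.

If `RG` is UnitUC, then so is `R`, because the augmentation `RG → R` is a split surjection. Each
`g ∈ G` is a unit of `RG`, so `1 - g ∈ J`, and also `2 = 1 - (-1) ∈ J`. Then `1 + g + g ^ 2` is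
congruent to `3`, hence a unit, and that excludes elements of infinite order. An element `h` of odd
order `m` has `1 + h + ⋯ + h ^ (m - 1)` congruent to `m`, hence a unit, and so `h = 1`.

Conversely, let `R` be UnitUC and `G` a locally finite `2`-group. Everything follows by lifting along
the augmentation once elements with augmentation in `J(R)` are known to lie in `J(RG)`, and this
amounts to the left invertibility of elements with augmentation in `1 + J(R)`, a question about
finite subgroups of `G`. For finite `G`, a simple `RG`-module `S` is finitely generated over `R`, so
`J(R) S = 0` by Nakayama's lemma. As `2 ∈ J(R)`, `S` has characteristic two, so the `2`-group `G` has
a nonzero fixed vector and acts trivially. Thus `RG` acts on `S` through the augmentation, and an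
element with augmentation in `1 + J(R)` lies in no maximal left ideal.
-/

/-! ### Units and the Jacobson radical -/

section RingTheory

variable {R : Type*} [Ring R]

theorem Ring.mem_jacobson_iff_forall_exists_mul_eq_one {x : R} :
    x ∈ Ring.jacobson R ↔ ∀ y, ∃ z, z * (1 + y * x) = 1 := by
  rw [← Ideal.jacobson_bot, Ideal.mem_jacobson_iff]
  refine forall_congr' fun y ↦ exists_congr fun z ↦ ?_
  rw [Ideal.mem_bot, sub_eq_zero, mul_add, mul_one, add_comm, mul_assoc]

theorem Ring.isUnit_one_add_of_mem_jacobson {x : R} (hx : x ∈ Ring.jacobson R) :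
    IsUnit (1 + x) := by
  obtain ⟨z, hz⟩ := Ring.mem_jacobson_iff_forall_exists_mul_eq_one.1 hx 1
  rw [one_mul] at hz
  -- `z = 1 - z * x` is again congruent to `1`, so it has a left inverse too.
  obtain ⟨t, ht⟩ := Ring.mem_jacobson_iff_forall_exists_mul_eq_one.1 hx (-z)
  have hz' : 1 + -z * x = z := by rw [← hz]; noncomm_ring
  rw [hz'] at ht
  have : t = 1 + x := left_inv_eq_right_inv ht hz
  exact ⟨⟨1 + x, z, by rw [← this, ht], hz⟩, rfl⟩

theorem Ring.isUnit_of_isUnit_map_of_ker_le_jacobson {S : Type*} [Ring S] (f : R →+* S)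
    (hf : Function.Surjective f) (hker : ∀ x, f x = 0 → x ∈ Ring.jacobson R) {a : R}
    (ha : IsUnit (f a)) : IsUnit a := by
  obtain ⟨u, hu⟩ := ha
  obtain ⟨b, hb⟩ := hf ↑u⁻¹
  have h1 : IsUnit (a * b) := by
    have := Ring.isUnit_one_add_of_mem_jacobson (hker (a * b - 1) (by simp [← hu, hb]))
    simpa using this
  have h2 : IsUnit (b * a) := by
    have := Ring.isUnit_one_add_of_mem_jacobson (hker (b * a - 1) (by simp [← hu, hb]))
    simpa using this
  obtain ⟨c, hc⟩ := h1.exists_right_inv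
  obtain ⟨d, hd⟩ := h2.exists_left_inv
  rw [mul_assoc] at hc
  rw [← mul_assoc] at hd
  have hdc : d * b = b * c := left_inv_eq_right_inv hd hc
  exact ⟨⟨a, b * c, hc, by rw [← hdc, hd]⟩, rfl⟩

/-- Jacobson's lemma: `(1 - b * a)⁻¹ = 1 + b * (1 - a * b)⁻¹ * a`. -/
theorem Ring.isUnit_one_sub_mul_swap {a b : R} (h : IsUnit (1 - a * b)) :
    IsUnit (1 - b * a) := by
  obtain ⟨u, hu⟩ := h
  have h1 : (1 - a * b) * (↑u⁻¹ : R) = 1 := by rw [← hu, u.mul_inv]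
  have h2 : (↑u⁻¹ : R) * (1 - a * b) = 1 := by rw [← hu, u.inv_mul]
  refine ⟨⟨1 - b * a, 1 + b * ↑u⁻¹ * a, ?_, ?_⟩, rfl⟩
  · have : (1 - b * a) * (1 + b * ↑u⁻¹ * a) =
        1 - b * a + b * ((1 - a * b) * ↑u⁻¹) * a := by noncomm_ring
    rw [this, h1]; noncomm_ring
  · have : (1 + b * ↑u⁻¹ * a) * (1 - b * a) =
        1 - b * a + b * (↑u⁻¹ * (1 - a * b)) * a := by noncomm_ring
    rw [this, h2]; noncomm_ring

/-! ### Idempotents in clean rings -/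

/-- Clean rings are exchange rings: if `a = e + u`, then `u⁻¹ * (1 - e) * u` is an idempotent in
`R * a` whose complement lies in `R * (1 - a)`. -/
theorem CleanRing.exists_isIdempotentElem_mul (hR : CleanRing R) (a : R) :
    ∃ f s t : R, IsIdempotentElem f ∧ f = s * a ∧ 1 - f = t * (1 - a) := by
  obtain ⟨e, u, he, rfl⟩ := hR a
  have hu : (↑u⁻¹ : R) * u = 1 := u.inv_mul
  have hu' : (u : R) * ↑u⁻¹ = 1 := u.mul_inv
  have hee : e * e = e := he
  have key : (e + u) - (e + u) * (e + u) = (u : R) - e * u - u * e - u * u := by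
    have : (e + u) - (e + u) * (e + u) = (u : R) - e * u - u * e - u * u + (e - e * e) := by
      noncomm_ring
    rw [this, hee, sub_self, add_zero]
  have hf : (↑u⁻¹ : R) * (1 - e) * u = (1 + ↑u⁻¹ * (1 - (e + u))) * (e + u) := by
    have : (1 + (↑u⁻¹ : R) * (1 - (e + u))) * (e + u) =
      e + u + ↑u⁻¹ * ((e + u) - (e + u) * (e + u)) := by noncomm_ring
    rw [this, key]
    have : e + u + (↑u⁻¹ : R) * ((u : R) - e * u - u * e - u * u) =
      ↑u⁻¹ * (1 - e) * u + (1 - ↑u⁻¹ * u) * (e + u) := by noncomm_ring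
    rw [this, hu]; noncomm_ring
  refine ⟨↑u⁻¹ * (1 - e) * u, 1 + ↑u⁻¹ * (1 - (e + u)), 1 - ↑u⁻¹ * (e + u), ?_, hf, ?_⟩
  · have : (↑u⁻¹ : R) * (1 - e) * u * (↑u⁻¹ * (1 - e) * u) =
        ↑u⁻¹ * (1 - e) * (u * ↑u⁻¹) * (1 - e) * u := by noncomm_ring
    rw [IsIdempotentElem, this, hu', mul_one, mul_assoc _ (1 - e) (1 - e), he.one_sub.eq]
  · rw [hf]; noncomm_ring

/-- In a clean ring, a left ideal that is not contained in the Jacobson radical contains a nonzero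
idempotent. The normalization `g * r = r` makes `x * r` an idempotent isomorphic to `g`. -/
theorem CleanRing.exists_isIdempotentElem_of_notMem_jacobson (hR : CleanRing R) {x : R}
    (hx : x ∉ Ring.jacobson R) :
    ∃ g r : R, g ≠ 0 ∧ IsIdempotentElem g ∧ g = r * x ∧ g * r = r := by
  rw [Ring.mem_jacobson_iff_forall_exists_mul_eq_one] at hx
  push Not at hx
  obtain ⟨y, hy⟩ := hx
  obtain ⟨f, s, t, hf, hfs, hft⟩ := hR.exists_isIdempotentElem_mul (-y * x)
  have hfx : f * (s * -y) * x = f := by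
    rw [mul_assoc, mul_assoc s, ← hfs, hf.eq]
  refine ⟨f, f * (s * -y), ?_, hf, hfx.symm, by rw [← mul_assoc, hf.eq]⟩
  rintro rfl
  refine hy t ?_
  rw [← sub_neg_eq_add, ← neg_mul, ← hft, sub_zero]

/-! ### Units of a UnitUC ring -/

namespace UnitUC

/-- The form in which the uniqueness of clean decompositions is used: if the corner of `1 - v` at `e`
is invertible in `e * R * e`, then `v⁻¹ = 0 + v⁻¹ = e + (v⁻¹ - e)` are two clean decompositions, so
`e` is conjugate to `0`. -/
theorem eq_zero_of_isUnit_one_sub_mul_mul (hR : UnitUC R) {e : R} (he : IsIdempotentElem e)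
    (v : Rˣ) (h : IsUnit (1 - e * v * e)) : e = 0 := by
  have h1 : IsUnit (1 - ↑v * e) := by
    have := Ring.isUnit_one_sub_mul_swap (a := e) (b := ↑v * e) (by rwa [← mul_assoc])
    rwa [mul_assoc, he.eq] at this
  obtain ⟨w, hw⟩ := (v⁻¹.isUnit.mul h1)
  have hw' : e + (w : R) = 0 + ↑v⁻¹ := by
    rw [hw, mul_sub, mul_one, ← mul_assoc, v.inv_mul]; noncomm_ring
  obtain ⟨z, hz⟩ := hR.2 e 0 w v⁻¹ he .zero hw'
  simpa using hz

/-- The elements `p`, `y` play the roles of the matrix units `E₁₂`, `E₂₁`; a UnitUC ring has no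
corner that is a nonzero `2 × 2` matrix ring. -/
theorem eq_zero_of_matrix_units (hR : UnitUC R) {p y : R} (hpp : p * p = 0) (hyy : y * y = 0)
    (hpyp : p * y * p = p) (hypy : y * p * y = y) : p = 0 := by
  have hpp' (z : R) : p * (p * z) = 0 := by rw [← mul_assoc, hpp, zero_mul]
  have hyy' (z : R) : y * (y * z) = 0 := by rw [← mul_assoc, hyy, zero_mul]
  rw [mul_assoc] at hpyp hypy
  have hpyp' (z : R) : p * (y * (p * z)) = p * z := by rw [← mul_assoc y, ← mul_assoc p, hpyp]
  have hypy' (z : R) : y * (p * (y * z)) = y * z := by rw [← mul_assoc p, ← mul_assoc y, hypy]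
  -- In terms of the matrix units, `v` is `!![1, -1; 1, 0]` on the corner and `1` off it,
  -- and `!![1, 0; 0, 1] - v = !![0, 1; -1, 1]` is invertible as well.
  let v : Rˣ := ⟨1 - y * p - p + y, 1 - p * y + p - y,
    by simp [mul_add, add_mul, mul_sub, sub_mul, mul_assoc, *]; abel,
    by simp [mul_add, add_mul, mul_sub, sub_mul, mul_assoc, *]; abel⟩
  have hv : (v : R) = 1 - y * p - p + y := rfl
  have hv' : ((v⁻¹ : Rˣ) : R) = 1 - p * y + p - y := rfl
  have h0 : p * y + y * p = 0 := by
    refine hR.eq_zero_of_isUnit_one_sub_mul_mul ?_ v ?_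
    · simp [IsIdempotentElem, mul_add, add_mul, mul_assoc, *]
    · have : 1 - (p * y + y * p) * v * (p * y + y * p) = ↑v⁻¹ := by
        rw [hv, hv']
        simp [mul_add, add_mul, mul_sub, sub_mul, mul_assoc, *]; abel
      rw [this]; exact v⁻¹.isUnit
  calc p = (p * y + y * p) * p := by
        rw [add_mul, mul_assoc, mul_assoc, hpyp, hpp, mul_zero, add_zero]
    _ = 0 := by rw [h0, zero_mul]

/-- The Peirce component `e * R * (1 - e)` lies in the Jacobson radical. Otherwise it contains an
element `x` with `r * x` a nonzero idempotent, and cutting `r` down to `(1 - e) * R * e` completes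
`x * (r * x)` to a pair of matrix units. -/
theorem mem_jacobson_of_mul_eq (hR : UnitUC R) {e x : R} (he : IsIdempotentElem e)
    (hex : e * x = x) (hxe : x * e = 0) : x ∈ Ring.jacobson R := by
  by_contra hx
  obtain ⟨g, r, hg0, hg, hgr, hgr'⟩ := hR.1.exists_isIdempotentElem_of_notMem_jacobson hx
  have hge : g * e = 0 := by rw [hgr, mul_assoc, hxe, mul_zero]
  have hxx : x * x = 0 := by rw [← hex, ← mul_assoc, mul_assoc e, hxe, mul_zero, zero_mul]
  have hrx : r * x = g := hgr.symm
  have hgg : g * g = g := hg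
  have hge' (z : R) : g * (e * z) = 0 := by rw [← mul_assoc, hge, zero_mul]
  have hex' (z : R) : e * (x * z) = x * z := by rw [← mul_assoc, hex]
  have hrx' (z : R) : r * (x * z) = g * z := by rw [← mul_assoc, hrx]
  have hgr'' (z : R) : g * (r * z) = r * z := by rw [← mul_assoc, hgr']
  clear hgr
  have hxg : x * g = 0 := by
    refine hR.eq_zero_of_matrix_units (y := (1 - e) * r * e) ?_ ?_ ?_ ?_
    · rw [← hrx]
      have : x * (r * x) * (x * (r * x)) = x * r * (x * x) * (r * x) := by noncomm_ring
      rw [this, hxx]; simp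
    · have : (1 - e) * r * e * ((1 - e) * r * e) = (1 - e) * r * (e - e * e) * r * e := by
        noncomm_ring
      rw [this, he.eq]; simp
    · simp [mul_sub, sub_mul, mul_assoc, *]
    · simp [mul_sub, sub_mul, mul_assoc, *]
  apply hg0
  rw [← hgg, ← hrx, mul_assoc, hrx, hxg, mul_zero]

/-- Idempotents of a UnitUC ring are central modulo the Jacobson radical. -/
theorem mul_sub_mul_mem_jacobson (hR : UnitUC R) {e : R} (he : IsIdempotentElem e) (x : R) :
    e * x - x * e ∈ Ring.jacobson R := by
  have hee : e * e = e := he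
  have hee' (z : R) : e * (e * z) = e * z := by rw [← mul_assoc, hee]
  have h1 : e * x - e * x * e ∈ Ring.jacobson R := by
    apply hR.mem_jacobson_of_mul_eq he <;> simp [mul_sub, sub_mul, mul_assoc, *]
  have h2 : x * e - e * x * e ∈ Ring.jacobson R := by
    apply hR.mem_jacobson_of_mul_eq he.one_sub <;> simp [mul_sub, sub_mul, mul_assoc, *]
  simpa using sub_mem h1 h2

/-- All units of a UnitUC ring are congruent to `1` modulo the Jacobson radical. Otherwise
`c = 1 - v` has a nonzero idempotent `e = r * c` as a left multiple, and as idempotents are central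
modulo the radical, `e * c * e` is invertible in the corner `e * R * e` with inverse `e * r * e` up
to the radical. -/
theorem one_sub_mem_jacobson (hR : UnitUC R) (v : Rˣ) : 1 - (v : R) ∈ Ring.jacobson R := by
  by_contra hx
  obtain ⟨e, r, he0, he, hrc, her⟩ := hR.1.exists_isIdempotentElem_of_notMem_jacobson hx
  set c : R := 1 - v with hc
  refine he0 (hR.eq_zero_of_isUnit_one_sub_mul_mul he v ?_)
  let q := Ideal.Quotient.mk (Ring.jacobson R)
  have hq (x : R) : q x = 0 → x ∈ Ring.jacobson R := Ideal.Quotient.eq_zero_iff_mem.1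
  refine Ring.isUnit_of_isUnit_map_of_ker_le_jacobson q Ideal.Quotient.mk_surjective hq ?_
  have central {g : R} (hg : IsIdempotentElem g) (x : R) : q g * q x = q x * q g := by
    rw [← map_mul, ← map_mul, ← sub_eq_zero, ← map_sub]
    exact Ideal.Quotient.eq_zero_iff_mem.2 (hR.mul_sub_mul_mem_jacobson hg x)
  have hf : IsIdempotentElem (c * r) := by
    rw [IsIdempotentElem, mul_assoc, ← mul_assoc r, ← hrc, her]
  -- The isomorphic idempotents `r * c` and `c * r` are central modulo the radical, hence equal.
  have hEE : q e * q e = q e := by rw [← map_mul, he.eq]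
  have hER : q e * q r = q r := by rw [← map_mul, her]
  have hRC : q r * q c = q e := by rw [← map_mul, ← hrc]
  have hCE : q c * q e = q e * q c := (central he c).symm
  have hRE : q r * q e = q r := by rw [← central he, hER]
  have hCR : q c * q r = q e := by
    have h1 : q e * q (c * r) = q (c * r) := by
      rw [map_mul, ← mul_assoc, ← hCE, mul_assoc, hER]
    have h2 : q (c * r) * q e = q e := by
      calc q (c * r) * q e = q (c * r) * q r * q c := by rw [mul_assoc, hRC]
        _ = (q r * q c) * (q r * q c) := by rw [central hf, map_mul]; simp only [mul_assoc]
        _ = q e := by rw [hRC, hEE]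
    rw [← map_mul, ← h1, central he, h2]
  have hv : q (1 - e * v * e) = 1 - q e + q e * q c * q e := by
    have : q v = 1 - q c := by rw [hc]; simp
    simp only [map_sub, map_mul, map_one, this, mul_sub, sub_mul, mul_one, hEE]
    abel
  have hEE' (z) : q e * (q e * z) = q e * z := by rw [← mul_assoc, hEE]
  have hRE' (z) : q r * (q e * z) = q r * z := by rw [← mul_assoc, hRE]
  rw [hv]
  refine ⟨⟨_, 1 - q e + q r, ?_, ?_⟩, rfl⟩ <;>
  · simp only [mul_add, add_mul, mul_sub, sub_mul, mul_assoc, mul_one, one_mul, hEE, hER, hRC,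
      hCE, hRE, hCR, hEE', hRE']
    abel

/-- A ring is UnitUC iff it is clean and its units are exactly the elements of `1 + J`. For the
converse, the idempotents of two clean decompositions are congruent modulo `J`, hence conjugate. -/
theorem iff_clean_and_one_sub_mem_jacobson :
    UnitUC R ↔ CleanRing R ∧ ∀ v : Rˣ, 1 - (v : R) ∈ Ring.jacobson R := by
  refine ⟨fun h ↦ ⟨h.1, h.one_sub_mem_jacobson⟩, fun ⟨hR, hU⟩ ↦ ⟨hR, ?_⟩⟩
  intro e f u v he hf h
  have hef : e - f ∈ Ring.jacobson R := by
    have : e - f = (1 - (u : R)) - (1 - v) := by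
      rw [sub_sub_sub_cancel_left, sub_eq_sub_iff_add_eq_add, h, add_comm]
    rw [this]; exact sub_mem (hU u) (hU v)
  have hw : IsUnit (f * e + (1 - f) * (1 - e)) := by
    have : f * e + (1 - f) * (1 - e) = 1 + ((2 * f - 1) * (e - f) + 2 * (f * f - f)) := by
      noncomm_ring
    rw [this, hf.eq, sub_self, mul_zero, add_zero]
    exact Ring.isUnit_one_add_of_mem_jacobson (Ideal.mul_mem_left _ _ hef)
  -- This unit intertwines the two idempotents.
  obtain ⟨w, hw⟩ := hw
  refine ⟨w, ?_⟩
  have hfw : f * w = w * e := by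
    have h1 : f * (f * e + (1 - f) * (1 - e)) =
      f * e + ((f * f - f) * e + (f - f * f) * (1 - e)) := by noncomm_ring
    have h2 : (f * e + (1 - f) * (1 - e)) * e =
      f * e + (f * (e * e - e) + (1 - f) * (e - e * e)) := by noncomm_ring
    rw [hw, h1, h2, hf.eq, he.eq]; simp
  rw [mul_assoc, hfw, ← mul_assoc, w.inv_mul, one_mul]

/-! ### Change of rings -/

theorem of_surjective (hR : UnitUC R) {S : Type*} [Ring S] (f : R →+* S)
    (hf : Function.Surjective f) (hU : ∀ u : Sˣ, ∃ v : Rˣ, f v = u) : UnitUC S := by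
  refine iff_clean_and_one_sub_mem_jacobson.2 ⟨fun a ↦ ?_, fun u ↦ ?_⟩
  · obtain ⟨b, rfl⟩ := hf a
    obtain ⟨e, u, he, rfl⟩ := hR.1 b
    exact ⟨f e, u.map (f : R →* S), he.map f, by simp⟩
  · obtain ⟨v, hv⟩ := hU u
    have : RingHomSurjective f := ⟨hf⟩
    have := Ring.le_comap_jacobson f (hR.one_sub_mem_jacobson v)
    simpa [hv] using this

/-- The UnitUC property lifts along a split surjection for which the preimage of the radical is
contained in the radical. -/
theorem of_rightInverse {S : Type*} [Ring S] (hS : UnitUC S) (f : R →+* S) (g : S →+* R)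
    (hfg : Function.RightInverse g f) (hJ : ∀ x, f x ∈ Ring.jacobson S → x ∈ Ring.jacobson R) :
    UnitUC R := by
  refine iff_clean_and_one_sub_mem_jacobson.2 ⟨fun a ↦ ?_, fun u ↦ ?_⟩
  · obtain ⟨e, u, he, hu⟩ := hS.1 (f a)
    have : IsUnit (a - g e) := by
      refine Ring.isUnit_of_isUnit_map_of_ker_le_jacobson f hfg.surjective
        (fun x hx ↦ hJ x (by simp [hx])) ?_
      rw [map_sub, hfg, hu, add_sub_cancel_left]
      exact u.isUnit
    obtain ⟨w, hw⟩ := this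
    exact ⟨g e, w, he.map g, by simp [hw]⟩
  · apply hJ
    simpa using hS.one_sub_mem_jacobson (u.map (f : R →* S))

theorem two_mem_jacobson (hR : UnitUC R) : (2 : R) ∈ Ring.jacobson R := by
  have := hR.one_sub_mem_jacobson (-1)
  rw [Units.val_neg, Units.val_one, sub_neg_eq_add, one_add_one_eq_two] at this
  exact this

end UnitUC

end RingTheory

/-! ### Torsion modulo the Jacobson radical -/

/-- An element of `1 + J` of odd order `m` is trivial when `2 ∈ J`: the geometric sum
`1 + x + ⋯ + x ^ (m - 1)` is congruent to `m`, hence to `1`, so it is a unit, and it kills `x - 1`. -/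
theorem eq_one_of_odd_pow_eq_one {R : Type*} [Ring R] (h2 : (2 : R) ∈ Ring.jacobson R) {x : R}
    (hx : 1 - x ∈ Ring.jacobson R) {m : ℕ} (hm : Odd m) (hxm : x ^ m = 1) : x = 1 := by
  let q := Ideal.Quotient.mk (Ring.jacobson R)
  have hqx : q x = 1 := by
    have : q (1 - x) = 0 := Ideal.Quotient.eq_zero_iff_mem.2 hx
    rw [map_sub, map_one, sub_eq_zero] at this
    exact this.symm
  have hq2 : q 2 = 0 := Ideal.Quotient.eq_zero_iff_mem.2 h2
  have hs : IsUnit (∑ i ∈ Finset.range m, x ^ i) := by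
    refine Ring.isUnit_of_isUnit_map_of_ker_le_jacobson q Ideal.Quotient.mk_surjective
      (fun _ ↦ Ideal.Quotient.eq_zero_iff_mem.1) ?_
    obtain ⟨k, rfl⟩ := hm
    have h : q (∑ i ∈ Finset.range (2 * k + 1), x ^ i) = 1 := by
      have h2' : (2 : R ⧸ Ring.jacobson R) = 0 := by rw [← hq2, map_ofNat]
      simp [map_sum, hqx, h2']
    rw [h]; exact isUnit_one
  have h0 : (∑ i ∈ Finset.range m, x ^ i) * (x - 1) = 0 := by
    rw [geom_sum_mul, hxm, sub_self]
  exact sub_eq_zero.1 (hs.mul_right_eq_zero.1 h0)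

/-- A finite `p`-group acting linearly on a nonzero `𝔽_p`-vector space of any dimension has a nonzero
fixed vector: the span of one orbit is finite of order divisible by `p`, so `0` is not its only
fixed point. -/
theorem IsPGroup.exists_ne_zero_forall_smul_eq {p : ℕ} [Fact p.Prime] {G : Type*} [Group G] [Finite G]
    (hG : IsPGroup p G) {M : Type*} [AddCommGroup M] [Module (ZMod p) M] [DistribMulAction G M]
    [Nontrivial M] : ∃ x : M, x ≠ 0 ∧ ∀ g : G, g • x = x := by
  obtain ⟨s, hs⟩ := exists_ne (0 : M)
  let P : Submodule (ZMod p) M := Submodule.span (ZMod p) (Set.range fun g : G ↦ g • s)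
  have hP (g : G) (x : M) (hx : x ∈ P) : g • x ∈ P := by
    induction hx using Submodule.span_induction with
    | mem x hx =>
      obtain ⟨k, rfl⟩ := hx
      exact Submodule.subset_span ⟨g * k, mul_smul g k s⟩
    | zero => rw [smul_zero]; exact zero_mem _
    | add x y _ _ hx hy => rw [smul_add]; exact add_mem hx hy
    | smul a x _ hx =>
      have : g • a • x = a • g • x :=
        ZMod.map_smul (DistribSMul.toAddMonoidHom M g) a x
      rw [this]; exact P.smul_mem _ hx
  let _ : MulAction G P :=
    { smul := fun g x ↦ ⟨g • (x : M), hP g x x.2⟩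
      one_smul := fun x ↦ Subtype.ext (one_smul G (x : M))
      mul_smul := fun g k x ↦ Subtype.ext (mul_smul g k (x : M)) }
  have hsP : s ∈ P := Submodule.subset_span ⟨1, one_smul G s⟩
  have : Module.Finite (ZMod p) P := .span_of_finite _ (Set.finite_range _)
  have : Finite P := Module.finite_of_finite (ZMod p)
  have hcard : p ∣ Nat.card P := by
    have : addOrderOf (⟨s, hsP⟩ : P) = p :=
      addOrderOf_eq_prime (Subtype.ext (ZModModule.char_nsmul_eq_zero p s)) fun h ↦ hs congr(($h : M))
    exact this.symm.dvd.trans (addOrderOf_dvd_natCard _)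
  obtain ⟨b, hb, hb0⟩ := hG.exists_fixed_point_of_prime_dvd_card_of_fixed_point P hcard
    (a := 0) fun g ↦ Subtype.ext (smul_zero g)
  exact ⟨b, fun h ↦ hb0 (Subtype.ext h.symm), fun g ↦ congr(($(hb g) : M))⟩

/-! ### Units of the group ring given by group elements -/

namespace MonoidAlgebra

variable {R : Type*} [Ring R] {G : Type*} [Group G]

/-- For `g` of infinite order, `1 + g + g ^ 2` is not a unit, already for degree reasons along the
subgroup `⟨g⟩`. -/
theorem isOfFinOrder_of_isUnit [Nontrivial R] {g : G}
    (h : IsUnit (1 + single g 1 + single g 1 ^ 2 : MonoidAlgebra R G)) : IsOfFinOrder g := by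
  by_contra hg
  have hinj : Function.Injective (fun n : ℤ ↦ g ^ n) := injective_zpow_iff_not_isOfFinOrder.2 hg
  obtain ⟨y, hy⟩ := h.exists_right_inv
  -- The coefficients of the inverse along the powers of `g`.
  let c : ℤ → R := fun n ↦ y.coeff (g ^ n)
  have hc (n : ℤ) : c n + c (n - 1) + c (n - 2) = if n = 0 then 1 else 0 := by
    have := congrArg (fun z : MonoidAlgebra R G ↦ z.coeff (g ^ n)) hy
    simp only [add_mul, one_mul, single_pow, one_pow, coeff_add, Finsupp.add_apply,
      coeff_single_mul_apply] at this
    have h1 : g⁻¹ * g ^ n = g ^ (n - 1) := by group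
    have h2 : (g ^ 2)⁻¹ * g ^ n = g ^ (n - 2) := by group
    rw [h1, h2] at this
    refine this.trans ?_
    have h3 : (1 : G) = g ^ n ↔ n = 0 := by
      rw [← hinj.eq_iff (a := n)]; simp [eq_comm]
    classical
    rw [one_def, coeff_single, Finsupp.single_apply]
    simp only [h3]
  have hfin : {n | c n ≠ 0}.Finite := by
    refine Set.Finite.subset (y.coeff.support.finite_toSet.preimage hinj.injOn) fun n hn ↦ ?_
    simpa using hn
  have hne : {n | c n ≠ 0}.Nonempty := by
    by_contra hne
    have hc0 (n : ℤ) : c n = 0 := by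
      by_contra h; exact hne ⟨n, h⟩
    simpa [hc0] using hc 0
  obtain ⟨a, ha, hamax⟩ := Set.exists_max_image _ id hfin hne
  obtain ⟨b, hb, hbmin⟩ := Set.exists_min_image _ id hfin hne
  have hgt {n : ℤ} (hn : a < n) : c n = 0 := by
    by_contra h; exact absurd (hamax n h) (not_le.2 hn)
  have hlt {n : ℤ} (hn : n < b) : c n = 0 := by
    by_contra h; exact absurd (hbmin n h) (not_le.2 hn)
  -- The top coefficient forces `a + 2 = 0`, the bottom one `b = 0`, but `b ≤ a`.
  have ha2 : a + 2 = 0 := by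
    by_contra h
    have := hc (a + 2)
    rw [if_neg h, hgt (by omega), hgt (by omega), add_sub_cancel_right] at this
    exact ha (by simpa using this)
  have hb0 : b = 0 := by
    by_contra h
    have := hc b
    rw [if_neg h, hlt (n := b - 1) (by omega), hlt (n := b - 2) (by omega)] at this
    exact hb (by simpa using this)
  have : b ≤ a := hamax b hb
  omega

theorem _root_.UnitUC.isPGroup_two [Nontrivial R] (h : UnitUC (MonoidAlgebra R G)) :
    IsPGroup 2 G := by
  have hJ (g : G) : 1 - (single g 1 : MonoidAlgebra R G) ∈ Ring.jacobson _ :=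
    h.one_sub_mem_jacobson ((toUnits g).map (of R G) : (MonoidAlgebra R G)ˣ)
  have h2 := h.two_mem_jacobson
  have hfin (g : G) : IsOfFinOrder g := by
    refine isOfFinOrder_of_isUnit (R := R) ?_
    -- Modulo the radical, `1 + g + g ^ 2` is congruent to `3`, hence to `1`.
    have : (1 + single g 1 + single g 1 ^ 2 : MonoidAlgebra R G) =
        1 + (2 - (2 + single g 1) * (1 - single g 1)) := by noncomm_ring
    rw [this]
    exact Ring.isUnit_one_add_of_mem_jacobson
      (sub_mem h2 (Ideal.mul_mem_left _ _ (hJ g)))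
  intro g
  obtain ⟨k, m, hm, hkm⟩ := Nat.exists_eq_two_pow_mul_odd (hfin g).orderOf_pos.ne'
  -- `g ^ 2 ^ k` has odd order `m`.
  refine ⟨k, ?_⟩
  have : (single (g ^ 2 ^ k) 1 : MonoidAlgebra R G) = 1 := by
    refine eq_one_of_odd_pow_eq_one h2 (hJ _) hm ?_
    rw [single_pow, ← pow_mul, ← hkm, pow_orderOf_eq_one, one_pow, one_def]
  rw [one_def] at this
  exact (single_left_inj one_ne_zero).1 this

/-! ### The augmentation map -/

variable (R G) in
/-- The augmentation map `∑ rᵢ gᵢ ↦ ∑ rᵢ` of the group ring. -/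
noncomputable def augmentation : MonoidAlgebra R G →+* R :=
  liftNCRingHom (.id R) 1 fun _ _ ↦ .one_right _

@[simp]
theorem augmentation_single (g : G) (r : R) : augmentation R G (single g r) = r := by
  simp [augmentation]

theorem augmentation_rightInverse :
    Function.RightInverse (singleOneRingHom : R →+* MonoidAlgebra R G) (augmentation R G) :=
  fun r ↦ by simp

theorem augmentation_comp_mapDomainRingHom {H : Type*} [Group H] (f : H →* G)
    (x : MonoidAlgebra R H) : augmentation R G (mapDomainRingHom R f x) = augmentation R H x := by
  have : (augmentation R G).comp (mapDomainRingHom R f) = augmentation R H := by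
    ext <;> simp
  exact congr($this x)

/-- Every element of the group ring `RG` comes from `RH` for a finitely generated subgroup `H`. -/
theorem exists_fg_mem_range_mapDomainRingHom (x : MonoidAlgebra R G) :
    ∃ H : Subgroup G, H.FG ∧ x ∈ (mapDomainRingHom R H.subtype).range := by
  have mono {H K : Subgroup G} (hHK : H ≤ K) :
      (mapDomainRingHom R H.subtype).range ≤ (mapDomainRingHom R K.subtype).range := by
    rw [← Subgroup.subtype_comp_inclusion hHK, mapDomainRingHom_comp]
    rintro _ ⟨y, rfl⟩
    exact ⟨_, rfl⟩
  induction x using induction_linear with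
  | zero => exact ⟨⊥, ⟨∅, by simp⟩, zero_mem _⟩
  | add x y hx hy =>
    obtain ⟨H, hH, hx⟩ := hx
    obtain ⟨K, hK, hy⟩ := hy
    exact ⟨H ⊔ K, hH.sup hK, add_mem (mono le_sup_left hx) (mono le_sup_right hy)⟩
  | single g r =>
    exact ⟨.zpowers g, ⟨{g}, by simp [Subgroup.zpowers_eq_closure]⟩,
      single ⟨g, Subgroup.mem_zpowers g⟩ r, by simp⟩

/-! ### Simple modules over the group ring of a finite `2`-group -/

/-- A simple module annihilated by `J(R)` is an `𝔽₂`-vector space, so it has nonzero `G`-fixed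
vectors; these form a submodule, so `G` acts trivially. -/
theorem smul_eq_augmentation_smul [Finite G] (hG : IsPGroup 2 G)
    (h2 : (2 : R) ∈ Ring.jacobson R) {S : Type*} [AddCommGroup S] [Module R S]
    [Module (MonoidAlgebra R G) S] [IsScalarTower R (MonoidAlgebra R G) S]
    (hJ : ∀ j ∈ Ring.jacobson R, ∀ s : S, j • s = 0)
    [IsSimpleModule (MonoidAlgebra R G) S] (x : MonoidAlgebra R G) (s : S) :
    x • s = augmentation R G x • s := by
  have hsing (g : G) (r : R) (s : S) : single g r • s = r • single g (1 : R) • s := by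
    rw [← smul_assoc, smul_single, smul_eq_mul, mul_one]
  have hcomm (g : G) (r : R) (s : S) : single g (1 : R) • r • s = r • single g (1 : R) • s := by
    have : r • s = single (1 : G) r • s := by rw [hsing, ← one_def, one_smul]
    rw [this, smul_smul, single_mul_single, mul_one, one_mul, hsing]
  -- The fixed points of `G` form a nonzero submodule, hence everything.
  let F : Submodule (MonoidAlgebra R G) S :=
    { carrier := {s | ∀ g : G, single g (1 : R) • s = s}
      add_mem' := fun hx hy g ↦ by rw [smul_add, hx g, hy g]
      zero_mem' := fun g ↦ smul_zero _
      smul_mem' := fun x s hs g ↦ by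
        induction x using induction_linear with
        | zero => simp
        | add x y hx hy => rw [add_smul, smul_add, hx, hy]
        | single k r => rw [hsing k r, hs k, hcomm, hs g] }
  have hF : F = ⊤ := by
    refine (eq_bot_or_eq_top F).resolve_left fun h ↦ ?_
    let _ : DistribMulAction G S := DistribMulAction.compHom S (of R G)
    have := IsSimpleModule.nontrivial (MonoidAlgebra R G) S
    let _ : Module (ZMod 2) S := AddCommGroup.zmodModule fun x ↦ by
      rw [← Nat.cast_smul_eq_nsmul R, Nat.cast_ofNat, hJ 2 h2]
    obtain ⟨x, hx0, hx⟩ := hG.exists_ne_zero_forall_smul_eq (M := S)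
    have hxF : x ∈ F := hx
    rw [h, Submodule.mem_bot] at hxF
    exact hx0 hxF
  have hs : s ∈ F := hF ▸ Submodule.mem_top
  induction x using induction_linear with
  | zero => simp
  | add x y hx hy => rw [add_smul, hx, hy, map_add, add_smul]
  | single g r => rw [hsing, hs g, augmentation_single]

/-- For a simple `RG`-module `S` finitely generated over `R`, the subgroup `J(R) S` is an
`RG`-submodule, proper by Nakayama's lemma, hence zero. -/
theorem smul_eq_zero_of_mem_jacobson {S : Type*} [AddCommGroup S] [Module R S]
    [Module (MonoidAlgebra R G) S] [IsScalarTower R (MonoidAlgebra R G) S] [Module.Finite R S]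
    [IsSimpleModule (MonoidAlgebra R G) S] {j : R} (hj : j ∈ Ring.jacobson R) (s : S) :
    j • s = 0 := by
  let N : Submodule (MonoidAlgebra R G) S :=
    { (Ring.jacobson R • (⊤ : Submodule R S)).toAddSubmonoid with
      smul_mem' := fun x s hs ↦ by
        change x • s ∈ Ring.jacobson R • (⊤ : Submodule R S)
        replace hs : s ∈ Ring.jacobson R • (⊤ : Submodule R S) := hs
        induction hs using Submodule.smul_induction_on' with
        | add y _ z _ hy hz => rw [smul_add]; exact add_mem hy hz
        | smul i hi t _ =>
          induction x using induction_linear with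
          | zero => rw [zero_smul]; exact zero_mem _
          | add x y hx hy => rw [add_smul]; exact add_mem hx hy
          | single g r =>
            have : single g r • i • t = (r * i) • single g (1 : R) • t := by
              rw [← one_smul (MonoidAlgebra R G) t, ← smul_assoc i, one_def, smul_single,
                smul_smul, single_mul_single, smul_smul, single_mul_single, ← smul_assoc,
                smul_single]
              simp
            rw [this]
            exact Submodule.smul_mem_smul (Ideal.mul_mem_left _ r hi) Submodule.mem_top }
  have hN : N = ⊥ := by
    refine (eq_bot_or_eq_top N).resolve_right fun h ↦ ?_
    have := IsSimpleModule.nontrivial (MonoidAlgebra R G) S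
    refine (Submodule.jacobson_smul_lt_top (R := R) (⊤ : Submodule R S)).ne ?_
    exact SetLike.coe_injective congr(($h : Set S))
  have hs : j • s ∈ Ring.jacobson R • (⊤ : Submodule R S) :=
    Submodule.smul_mem_smul hj Submodule.mem_top
  have hsN : j • s ∈ N := hs
  rwa [hN, Submodule.mem_bot] at hsN

/-- If `a` generated a proper left ideal, it would annihilate the class of `1` in the quotient by a
maximal left ideal. But it acts on that simple module as `augmentation R G a`, thus as `1`. -/
theorem exists_mul_eq_one_of_augmentation_sub_one_mem [Finite G] (hG : IsPGroup 2 G)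
    (h2 : (2 : R) ∈ Ring.jacobson R) {a : MonoidAlgebra R G}
    (ha : augmentation R G a - 1 ∈ Ring.jacobson R) : ∃ b, b * a = 1 := by
  by_contra! hab
  have hspan : Ideal.span {a} ≠ ⊤ := fun h ↦ by
    obtain ⟨b, hb⟩ := Ideal.mem_span_singleton'.1 ((Ideal.eq_top_iff_one _).1 h)
    exact hab b hb
  obtain ⟨M, hM, haM⟩ := Ideal.exists_le_maximal (Ideal.span {a}) hspan
  have : IsSimpleModule (MonoidAlgebra R G) (MonoidAlgebra R G ⧸ M) :=
    isSimpleModule_iff_isCoatom.2 hM.out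
  have : Module.Finite R (MonoidAlgebra R G ⧸ M) := .quotient R M
  have hJ {j : R} (hj : j ∈ Ring.jacobson R) (s : MonoidAlgebra R G ⧸ M) : j • s = 0 :=
    smul_eq_zero_of_mem_jacobson (G := G) hj s
  have h1 : a • M.mkQ 1 = 0 := by
    rw [← map_smul, smul_eq_mul, mul_one, Submodule.mkQ_apply, Submodule.Quotient.mk_eq_zero]
    exact haM (Ideal.mem_span_singleton_self a)
  have h3 := hJ ha (M.mkQ 1)
  rw [sub_smul, ← smul_eq_augmentation_smul hG h2 (fun _ ↦ hJ), h1, one_smul, zero_sub,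
    neg_eq_zero, Submodule.mkQ_apply, Submodule.Quotient.mk_eq_zero] at h3
  exact hM.ne_top ((Ideal.eq_top_iff_one _).2 h3)

/-! ### Locally finite `2`-groups -/

theorem mem_jacobson_of_augmentation_mem (hGf : LocallyFiniteGroup G) (hG : IsPGroup 2 G)
    (h2 : (2 : R) ∈ Ring.jacobson R) {x : MonoidAlgebra R G}
    (hx : augmentation R G x ∈ Ring.jacobson R) : x ∈ Ring.jacobson (MonoidAlgebra R G) := by
  rw [Ring.mem_jacobson_iff_forall_exists_mul_eq_one]
  intro y
  obtain ⟨H, hH, a, ha⟩ := exists_fg_mem_range_mapDomainRingHom (1 + y * x)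
  have := hGf H hH
  obtain ⟨b, hb⟩ := exists_mul_eq_one_of_augmentation_sub_one_mem (R := R) (hG.to_subgroup H) h2
    (a := a) (by
      rw [← augmentation_comp_mapDomainRingHom H.subtype, ha]
      simpa using Ideal.mul_mem_left _ _ hx)
  exact ⟨mapDomainRingHom R H.subtype b, by rw [← ha, ← map_mul, hb, map_one]⟩

end MonoidAlgebra

open MonoidAlgebra in
theorem theorem19 {R : Type*} [Ring R] [Nontrivial R] {G : Type*} [Group G] :
    (UnitUC (MonoidAlgebra R G) → UnitUC R ∧ IsPGroup 2 G) ∧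
    (UnitUC R → LocallyFiniteGroup G → IsPGroup 2 G → UnitUC (MonoidAlgebra R G)) := by
  refine ⟨fun h ↦ ⟨?_, h.isPGroup_two⟩, fun hR hGf hG ↦ ?_⟩
  · refine h.of_surjective (augmentation R G) augmentation_rightInverse.surjective fun u ↦ ?_
    exact ⟨u.map (singleOneRingHom : R →+* MonoidAlgebra R G), by simp⟩
  · exact hR.of_rightInverse (augmentation R G) singleOneRingHom augmentation_rightInverse
      fun x hx ↦ mem_jacobson_of_augmentation_mem hGf hG hR.two_mem_jacobson hx
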